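/- Let $r \ge 3$, let $\zeta$ be a primitive $2^r$-th root of unity in a field of characteristic $0$, and let $K$ be a subfield of that field which is an abelian extension of $\mathbb{Q}$ of conductor $2^r$, that is, $K \subseteq \mathbb{Q}(\zeta)$ and $K \not\subseteq \mathbb{Q}(\zeta^2)$. Let $n = [K:\mathbb{Q}]$, let $\mathcal{O}_K$ be the ring of integers of $K$, let $D_K$ be the absolute value of the discriminant of $K$, and let $$M(K) = \sup_{x \in K}\ \inf_{c \in \mathcal{O}_K} |N_{K/\mathbb{Q}}(x-c)|$$ be the Euclidean minimum of $K$. Then $K = \mathbb{Q}(\zeta)$, $K = \mathbb{Q}(\zeta+\zeta^{-1})$ or $K = \mathbb{Q}(\zeta-\zeta^{-1})$. Moreover: (a) If $K = \mathbb{Q}(\zeta)$ or $K = \mathbb{Q}(\zeta+\zeta^{-1})$, then $M(K) \le 2^{-n}\sqrt{D_K}$. (b) If $K = \mathbb{Q}(\zeta-\zeta^{-1})$, then $M(K) \le 2^{-n}(2n-1)^{n/2}$. In this case $K$ has a complex conjugation $\tau$ (an automorphism that every embedding $K \to \mathbb{C}$ turns into the conjugation of $\mathbb{C}$), the trace form $q(x,y)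 = \mathrm{Tr}_{K/\mathbb{Q}}(x\,\tau(y))$ on $\mathcal{O}_K$ has Gram matrix $\mathrm{diag}(n,2n,\dots,2n)$ in a suitable $\mathbb{Z}$-basis of $\mathcal{O}_K$, and $D_K = n^n 2^{n-1}$. -/

import Mathlib

open IntermediateField NumberField

noncomputable section

/-- The Euclidean minimum `M(K) = sup_{x ∈ K} inf_{c ∈ 𝓞 K} |N_{K/ℚ}(x - c)|`, with the infimum and
the supremum taken in the extended reals, so that no boundedness is presupposed. -/
def euclideanMinimum (K : Type*) [Field K] [NumberField K] : EReal :=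
  ⨆ x : K, ⨅ c : 𝓞 K, (((|Algebra.norm ℚ (x - (c : K))| : ℚ) : ℝ) : EReal)

/-- The subfield `K` of `L` has conductor `2 ^ r`: for `ζ` a primitive `2 ^ r`-th root of unity, `K` is
contained in `ℚ(ζ)` but not in `ℚ(ζ ^ 2)` (the two fields do not depend on the choice of `ζ`). -/
def HasConductorTwoPow {L : Type*} [Field L] [CharZero L] (K : IntermediateField ℚ L) (r : ℕ) :
    Prop :=
  ∃ ζ : L, IsPrimitiveRoot ζ (2 ^ r) ∧ K ≤ ℚ⟮ζ⟯ ∧ ¬ K ≤ ℚ⟮ζ ^ 2⟯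

/-- `τ` is the complex conjugation of `K`: every embedding of `K` in `ℂ` turns `τ` into the
conjugation of `ℂ`. There is at most one such `τ`. -/
def IsComplexConjugation {K : Type*} [Field K] (τ : K ≃+* K) : Prop :=
  ∀ (φ : K →+* ℂ) (x : K), φ (τ x) = (starRingEnd ℂ) (φ x)

/-- The trace form `q(x, y) = Tr_{K/ℚ}(x τ(y))` on the ring of integers. -/
def conjTraceForm {K : Type*} [Field K] [NumberField K] (τ : K ≃+* K) (x y : 𝓞 K) : ℚ :=
  Algebra.trace ℚ K ((x : K) * τ (y : K))

end

/-!
Write `E = ℚ(ζ)`, of degree `2 ^ (r - 1)`.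

*Classification.* The group `H = Gal(E/K)` consists of maps `ζ ↦ ζ ^ a` with `a` odd. If `H`
contained a nontrivial element with `a ≡ 1 mod 4`, some power of it would be `ζ ↦ -ζ`, and `K`
would lie in `ℚ(ζ ^ 2)`. So the map `a ↦ a mod 4` is injective on `H`, which has at most one
nontrivial element; that element is an involution with `a ≡ 3 mod 4`, hence is `ζ ↦ ε ζ⁻¹` with `ε
= ±1`, and its fixed field is `ℚ(ζ + ε ζ⁻¹)` (`eq_top_or_eq_adjoin`).

*Integers.* Put `θ = ζ + ε ζ⁻¹`. As `ζ ^ 2 = θ ζ - ε`, every element of `ℤ[ζ]` is `a + b ζ` with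
`a, b ∈ ℤ[θ]`, and it is fixed by `ζ ↦ ε ζ⁻¹` only if `b = 0`. Since `ℤ[ζ]` is the ring of
integers of `E`, that of `ℚ(θ)` is `ℤ[θ]`. The elements `1` and `ζ ^ i + ε ^ i ζ ^ (-i)` for `0 <
i < 2 ^ (r - 2)` span it, because multiplication by `θ` acts on them by a three-term recurrence
that closes up: the element with `i = 2 ^ (r - 2)` vanishes. They are orthogonal for the trace
form since `ζ ^ k` has trace zero for `0 < |k| < 2 ^ (r - 1)`, which yields the Gram matrix and
the discriminant.

*Euclidean minimum.* Let `α` be totally nonnegative and let integers `e i` span `K` over `ℚ` and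
be orthogonal for the form `Tr (α x τ(y))`, with squares `d i`. Rounding the coordinates of `x`
gives an integer `c` such that the form takes a value at most `(∑ d i) / 4` at `x - c`, and the
inequality of the arithmetic and geometric mean over the complex embeddings turns this into a
bound for `|N(α)| N(x - c) ^ 2` (`exists_abs_norm_mul_norm_sub_sq_le`). For `ℚ(ζ)` take `α = 1`
and the powers of `ζ`; for `ε = -1` take `α = 1` and the basis above. For the real field `ε = 1`
this choice is not good enough: there `α = 2 - θ`, of norm `2` in absolute value, and the partial
sums of the basis are orthogonal with all squares equal, so that the lattice is cubic.
-/

/-! ### Euclidean minima and weighted trace forms -/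

theorem euclideanMinimum_le {K : Type*} [Field K] [NumberField K] {B : ℝ}
    (h : ∀ x : K, ∃ c : 𝓞 K, ((|Algebra.norm ℚ (x - (c : K))| : ℚ) : ℝ) ≤ B) :
    euclideanMinimum K ≤ (B : EReal) := by
  refine iSup_le fun x => ?_
  obtain ⟨c, hc⟩ := h x
  exact iInf_le_of_le c (EReal.coe_le_coe_iff.mpr hc)

theorem abs_le_inv_two_pow_mul_sqrt {q : ℚ} {n : ℕ} {D : ℝ} (h : (q : ℝ) ^ 2 * 4 ^ n ≤ D) :
    ((|q| : ℚ) : ℝ) ≤ ((2 : ℝ) ^ n)⁻¹ * √D := by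
  have h1 : (2 : ℝ) ^ n * |(q : ℝ)| ≤ √D := by
    refine Real.le_sqrt_of_sq_le (le_trans (le_of_eq ?_) h)
    rw [mul_pow, sq_abs, ← pow_mul, mul_comm n 2, pow_mul]
    norm_num
    ring
  rw [Rat.cast_abs, inv_mul_eq_div, le_div_iff₀ (by positivity)]
  linarith

/-- The inequality of the arithmetic and geometric mean for the numbers `‖φ α‖ * ‖φ y‖ ^ 2`, where
`φ` runs over the complex embeddings of `K`. -/
theorem abs_norm_mul_norm_sq_le {K : Type*} [Field K] [NumberField K] {τ : K ≃+* K}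
    (hτ : IsComplexConjugation τ) {α : K} (hα : ∀ φ : K →+* ℂ, φ α = (‖φ α‖ : ℂ)) (y : K) :
    |Algebra.norm ℚ α| * Algebra.norm ℚ y ^ 2 ≤
      (Algebra.trace ℚ K (α * (y * τ y)) / Module.finrank ℚ K) ^ Module.finrank ℚ K := by
  classical
  set n := Module.finrank ℚ K with hn
  have hn0 : 0 < n := Module.finrank_pos
  have hcard : Fintype.card (K →ₐ[ℚ] ℂ) = n := AlgHom.card ℚ K ℂ
  let z : (K →ₐ[ℚ] ℂ) → ℝ := fun φ => ‖φ α‖ * ‖φ y‖ ^ 2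
  have hz : ∀ φ, 0 ≤ z φ := fun φ => by positivity
  have hprod : ((|Algebra.norm ℚ α| * Algebra.norm ℚ y ^ 2 : ℚ) : ℝ) = ∏ φ, z φ := by
    have h1 : ∀ w : K, |((Algebra.norm ℚ w : ℚ) : ℝ)| = ∏ φ : K →ₐ[ℚ] ℂ, ‖φ w‖ := fun w => by
      rw [← norm_prod, ← Algebra.norm_eq_prod_embeddings ℚ ℂ w]
      simp
    simp only [z]
    rw [Finset.prod_mul_distrib, Finset.prod_pow, ← h1, ← h1, sq_abs]
    push_cast
    rfl
  have hsum : ((Algebra.trace ℚ K (α * (y * τ y)) : ℚ) : ℝ) = ∑ φ, z φ := by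
    have h1 : ((Algebra.trace ℚ K (α * (y * τ y)) : ℚ) : ℂ) = ((∑ φ, z φ : ℝ) : ℂ) := by
      have := trace_eq_sum_embeddings (K := ℚ) (L := K) ℂ (x := α * (y * τ y))
      rw [eq_ratCast] at this
      rw [this]
      push_cast
      refine Finset.sum_congr rfl fun φ _ => ?_
      have h2 := hα (φ : K →+* ℂ)
      have h3 := hτ (φ : K →+* ℂ) y
      simp only [RingHom.coe_coe] at h2 h3
      rw [map_mul, map_mul, h3, Complex.mul_conj, Complex.normSq_eq_norm_sq, h2]
      simp [z]
    exact_mod_cast h1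
  have key : ∏ φ, z φ ≤ ((∑ φ, z φ) / n) ^ n := by
    have h := Real.geom_mean_le_arith_mean Finset.univ (fun _ : K →ₐ[ℚ] ℂ => (1 : ℝ)) z
      (fun _ _ => zero_le_one) (by simp [hcard, hn0]) (fun φ _ => hz φ)
    simp only [Real.rpow_one, one_mul, Finset.sum_const, Finset.card_univ, hcard, nsmul_eq_mul,
      mul_one] at h
    have h0 : 0 ≤ ∏ φ, z φ := Finset.prod_nonneg fun φ _ => hz φ
    calc ∏ φ, z φ = ((∏ φ, z φ) ^ ((n : ℝ)⁻¹)) ^ n :=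
          (Real.rpow_inv_natCast_pow h0 hn0.ne').symm
      _ ≤ _ := pow_le_pow_left₀ (Real.rpow_nonneg h0 _) h n
  rw [← hprod, ← hsum] at key
  exact_mod_cast key

/-- An orthogonal system of integers for a weighted trace form bounds the norm of `x` modulo the
integers: all coordinates of `x` can be reduced to absolute value at most `1 / 2`. -/
theorem exists_abs_norm_mul_norm_sub_sq_le {K : Type*} [Field K] [NumberField K] {τ : K ≃+* K}
    (hτ : IsComplexConjugation τ) {α : K} (hα : ∀ φ : K →+* ℂ, φ α = (‖φ α‖ : ℂ))
    {ι : Type*} [Fintype ι] [DecidableEq ι] {e : ι → 𝓞 K}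
    (he : ⊤ ≤ Submodule.span ℚ (Set.range fun i => (e i : K))) {d : ι → ℚ} (hd0 : ∀ i, 0 ≤ d i)
    (hd : ∀ i j, Algebra.trace ℚ K (α * ((e i : K) * τ (e j))) = if i = j then d i else 0)
    (x : K) : ∃ c : 𝓞 K, |Algebra.norm ℚ α| * Algebra.norm ℚ (x - (c : K)) ^ 2 ≤
      ((∑ i, d i) / (4 * Module.finrank ℚ K)) ^ Module.finrank ℚ K := by
  obtain ⟨t, ht⟩ := (Submodule.mem_span_range_iff_exists_fun ℚ).1 (he (Submodule.mem_top (x := x)))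
  let s : ι → ℚ := fun i => t i - round (t i)
  have hs : ∀ i, s i ^ 2 ≤ 1 / 4 := fun i => by
    have := abs_sub_round (t i)
    have h2 := sq_le_sq' (abs_le.1 this).1 (abs_le.1 this).2
    calc s i ^ 2 ≤ (1 / 2) ^ 2 := h2
      _ = 1 / 4 := by norm_num
  refine ⟨∑ i, round (t i) • e i, ?_⟩
  set y : K := x - ((∑ i, round (t i) • e i : 𝓞 K) : K) with hy
  have hys : y = ∑ i, s i • (e i : K) := by
    rw [hy, ← ht]
    simp only [s, map_sum, sub_smul, Finset.sum_sub_distrib]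
    congr 1
    refine Finset.sum_congr rfl fun i _ => ?_
    rw [zsmul_eq_mul, map_mul, map_intCast, Rat.smul_def, Rat.cast_intCast]
  have htr : Algebra.trace ℚ K (α * (y * τ y)) = ∑ i, s i ^ 2 * d i := by
    have h1 : α * (y * τ y) = ∑ i, ∑ j, (s i * s j) • (α * ((e i : K) * τ (e j))) := by
      rw [hys, map_sum, Finset.sum_mul_sum, Finset.mul_sum]
      refine Finset.sum_congr rfl fun i _ => ?_
      rw [Finset.mul_sum]
      refine Finset.sum_congr rfl fun j _ => ?_
      simp only [Rat.smul_def, map_mul, map_ratCast, Rat.cast_mul]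
      ring
    rw [h1]
    simp only [map_sum, map_smul, hd, smul_eq_mul, mul_ite, mul_zero, Finset.sum_ite_eq,
      Finset.mem_univ, if_true, sq]
  refine (abs_norm_mul_norm_sq_le hτ hα y).trans ?_
  rw [htr]
  have hle : ∑ i, s i ^ 2 * d i ≤ (∑ i, d i) / 4 := by
    rw [Finset.sum_div]
    refine Finset.sum_le_sum fun i _ => ?_
    have := mul_le_mul_of_nonneg_right (hs i) (hd0 i)
    linarith
  have h0 : 0 ≤ ∑ i, s i ^ 2 * d i := Finset.sum_nonneg fun i _ => mul_nonneg (sq_nonneg _) (hd0 i)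
  rw [← div_div]
  gcongr

/-! ### Roots of unity of two-power order -/

theorem IsPrimitiveRoot.two_pow_half {R : Type*} [CommRing R] [IsDomain R] {ζ : R} {r : ℕ}
    (hr : 1 ≤ r) (hζ : IsPrimitiveRoot ζ (2 ^ r)) : ζ ^ 2 ^ (r - 1) = -1 := by
  have h1 : (ζ ^ 2 ^ (r - 1)) ^ 2 = 1 := by
    rw [← pow_mul, ← pow_succ, Nat.sub_add_cancel hr, hζ.pow_eq_one]
  refine (sq_eq_one_iff.1 h1).resolve_left fun h => ?_
  exact absurd (Nat.le_of_dvd (by positivity) (hζ.dvd_of_pow_eq_one _ h))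
    (not_le.2 (Nat.pow_lt_pow_right one_lt_two (by omega)))

section Cyclotomic

variable {E : Type*} [Field E] [NumberField E] {r : ℕ} [IsCyclotomicExtension {2 ^ r} ℚ E]

theorem exists_algEquiv_apply_eq {ζ η : E} (hζ : IsPrimitiveRoot ζ (2 ^ r))
    (hη : IsPrimitiveRoot η (2 ^ r)) : ∃ σ : E ≃ₐ[ℚ] E, σ ζ = η := by
  have hirr : Irreducible (Polynomial.cyclotomic (2 ^ r) ℚ) :=
    Polynomial.cyclotomic.irreducible_rat (by positivity)
  refine ⟨(IsCyclotomicExtension.fromZetaAut hζ hirr).symm.trans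
    (IsCyclotomicExtension.fromZetaAut hη hirr), ?_⟩
  have h : (IsCyclotomicExtension.fromZetaAut hζ hirr).symm ζ =
      IsCyclotomicExtension.zeta (2 ^ r) ℚ E := by
    rw [AlgEquiv.symm_apply_eq, IsCyclotomicExtension.fromZetaAut_spec]
  rw [AlgEquiv.trans_apply, h, IsCyclotomicExtension.fromZetaAut_spec]

/-- Some automorphism maps `ζ ^ k` to `-ζ ^ k`: if `2 ^ a` is the exact power of two in `k`, then
`ζ ↦ ζ ^ (1 + 2 ^ (r - 1 - a))` does. -/
theorem trace_pow_eq_zero {ζ : E} (hζ : IsPrimitiveRoot ζ (2 ^ r)) {k : ℕ} (hk0 : k ≠ 0)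
    (hk : k < 2 ^ (r - 1)) : Algebra.trace ℚ E (ζ ^ k) = 0 := by
  obtain ⟨a, m, hm, rfl⟩ := Nat.exists_eq_two_pow_mul_odd hk0
  have ha : a < r - 1 := by
    refine (Nat.pow_lt_pow_iff_right one_lt_two).1 (lt_of_le_of_lt ?_ hk)
    exact Nat.le_mul_of_pos_right _ hm.pos
  have hodd : Odd (1 + 2 ^ (r - 1 - a)) :=
    (Even.pow_of_ne_zero even_two (by omega)).one_add
  obtain ⟨σ, hσ⟩ := exists_algEquiv_apply_eq hζ
    (hζ.pow_of_coprime _ ((Nat.coprime_two_right.2 hodd).pow_right r))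
  have h1 : σ (ζ ^ (2 ^ a * m)) = -ζ ^ (2 ^ a * m) := by
    rw [map_pow, hσ, ← pow_mul, add_mul, one_mul, pow_add,
      show 2 ^ (r - 1 - a) * (2 ^ a * m) = 2 ^ (r - 1) * m by
        rw [← mul_assoc, ← pow_add, Nat.sub_add_cancel ha.le],
      pow_mul ζ (2 ^ (r - 1)) m, hζ.two_pow_half (by omega), hm.neg_one_pow, mul_neg_one]
  have h2 := Algebra.trace_eq_of_algEquiv σ (ζ ^ (2 ^ a * m))
  rw [h1, map_neg] at h2
  linarith

theorem finrank_eq_two_pow (hr : 1 ≤ r) : Module.finrank ℚ E = 2 ^ (r - 1) := by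
  rw [IsCyclotomicExtension.Rat.finrank (2 ^ r) E, Nat.totient_prime_pow Nat.prime_two hr]
  simp

theorem trace_zpow {ζ : E} (hr : 1 ≤ r) (hζ : IsPrimitiveRoot ζ (2 ^ r)) {k : ℤ}
    (hk : |k| < 2 ^ (r - 1)) :
    Algebra.trace ℚ E (ζ ^ k) = if k = 0 then 2 ^ (r - 1) else 0 := by
  split_ifs with h0
  · rw [h0, zpow_zero, ← map_one (algebraMap ℚ E), Algebra.trace_algebraMap,
      finrank_eq_two_pow hr]
    simp
  · have h2 : k.natAbs < 2 ^ (r - 1) := by zify; exact hk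
    rcases Int.natAbs_eq k with h | h <;> rw [h]
    · rw [zpow_natCast]
      exact trace_pow_eq_zero hζ (Int.natAbs_ne_zero.2 h0) h2
    · rw [zpow_neg, ← inv_zpow, zpow_natCast]
      exact trace_pow_eq_zero hζ.inv (Int.natAbs_ne_zero.2 h0) h2

end Cyclotomic

/-! ### Quadratic extensions generated by a root of unity -/

theorem exists_add_mul_of_mem_adjoin {R A : Type*} [CommRing R] [CommRing A] [Algebra R A]
    {S : Subalgebra R A} {ζ p q : A} (hp : p ∈ S) (hq : q ∈ S) (hζ : ζ * ζ = p * ζ + q) {x : A}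
    (hx : x ∈ Algebra.adjoin R {ζ}) : ∃ a ∈ S, ∃ b ∈ S, x = a + b * ζ := by
  induction hx using Algebra.adjoin_induction with
  | mem x hx => exact ⟨0, S.zero_mem, 1, S.one_mem, by simp_all⟩
  | algebraMap c => exact ⟨_, S.algebraMap_mem c, 0, S.zero_mem, by simp⟩
  | add x y _ _ hx hy =>
    obtain ⟨a, ha, b, hb, rfl⟩ := hx
    obtain ⟨c, hc, d, hd, rfl⟩ := hy
    exact ⟨a + c, S.add_mem ha hc, b + d, S.add_mem hb hd, by ring⟩
  | mul x y _ _ hx hy =>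
    obtain ⟨a, ha, b, hb, rfl⟩ := hx
    obtain ⟨c, hc, d, hd, rfl⟩ := hy
    refine ⟨a * c + b * d * q, S.add_mem (S.mul_mem ha hc) (S.mul_mem (S.mul_mem hb hd) hq),
      a * d + b * c + b * d * p, S.add_mem (S.add_mem (S.mul_mem ha hd) (S.mul_mem hb hc))
        (S.mul_mem (S.mul_mem hb hd) hp), ?_⟩
    linear_combination b * d * hζ

/-- If `ζ` is quadratic over `S`, an endomorphism that fixes `S` pointwise and moves `ζ` has no
fixed points in `R[ζ]` outside `S`. No linear independence of `1` and `ζ` is needed: `a + b ζ` is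
fixed only if `b (σ ζ - ζ) = 0`. -/
theorem mem_of_fixed_of_mem_adjoin {R A F : Type*} [CommRing R] [CommRing A] [IsDomain A]
    [Algebra R A] [FunLike F A A] [RingHomClass F A A] {S : Subalgebra R A} {ζ p q : A}
    (hp : p ∈ S) (hq : q ∈ S) (hζ : ζ * ζ = p * ζ + q) {σ : F} (hσ : ∀ s ∈ S, σ s = s)
    (hσζ : σ ζ ≠ ζ) {x : A} (hx : x ∈ Algebra.adjoin R {ζ}) (hfix : σ x = x) : x ∈ S := by
  obtain ⟨a, ha, b, hb, rfl⟩ := exists_add_mul_of_mem_adjoin hp hq hζ hx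
  rw [map_add, map_mul, hσ a ha, hσ b hb] at hfix
  have h : b * (σ ζ - ζ) = 0 := by linear_combination hfix
  rcases mul_eq_zero.1 h with h | h
  · simpa [h] using ha
  · exact absurd (sub_eq_zero.1 h) hσζ

/-! ### Power sums as Dickson polynomials -/

section DicksonBasis

open Polynomial

/-- For `θ = z + ε z⁻¹` the element `z ^ i + (ε z⁻¹) ^ i`, written as a Dickson polynomial in `θ`,
except that it is `1` instead of `2` for `i = 0`. -/
noncomputable def dicksonBasis {A : Type*} [CommRing A] (ε : ℤ) (θ : A) (i : ℕ) : A :=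
  if i = 0 then 1 else aeval θ (dickson 1 ε i)

variable {A : Type*} [CommRing A] (ε : ℤ) (θ : A)

theorem aeval_dickson_add_two (i : ℕ) : aeval θ (dickson 1 ε (i + 2)) =
    θ * aeval θ (dickson 1 ε (i + 1)) - ε * aeval θ (dickson 1 ε i) := by
  rw [dickson_add_two]
  simp

theorem aeval_dickson_zero : aeval θ (dickson 1 ε 0) = (2 : A) := by
  rw [dickson_zero, map_sub, map_ofNat]
  norm_num

theorem aeval_dickson_eq_add {z w : A} (hθ : θ = z + w) (hzw : z * w = ε) (i : ℕ) :
    aeval θ (dickson 1 ε i) = z ^ i + w ^ i := by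
  induction i using Nat.twoStepInduction with
  | zero => rw [aeval_dickson_zero]; norm_num
  | one => simp [dickson_one, hθ]
  | more i h1 h2 =>
    rw [aeval_dickson_add_two, h1, h2, hθ, ← hzw]
    ring

theorem map_dicksonBasis {B : Type*} [CommRing B] (f : A →+* B) (i : ℕ) :
    f (dicksonBasis ε θ i) = dicksonBasis ε (f θ) i := by
  unfold dicksonBasis
  split_ifs
  · simp
  · rw [aeval_def, aeval_def, hom_eval₂]
    congr 1
    exact Subsingleton.elim _ _

theorem mul_dicksonBasis (i : ℕ) : θ * dicksonBasis ε θ i = dicksonBasis ε θ (i + 1) +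
    (if i = 0 then 0 else if i = 1 then 2 * ε else ε) * dicksonBasis ε θ (i - 1) := by
  match i with
  | 0 => simp [dicksonBasis, dickson_one]
  | 1 =>
    have := aeval_dickson_add_two ε θ 0
    rw [zero_add, aeval_dickson_zero] at this
    simp only [dicksonBasis, one_ne_zero, if_false, if_true, Nat.reduceAdd, OfNat.ofNat_ne_zero,
      this, Nat.sub_self, dickson_one, aeval_X, zero_add]
    push_cast
    ring
  | i + 2 =>
    have := aeval_dickson_add_two ε θ (i + 1)
    simp only [dicksonBasis, Nat.add_eq_zero_iff, OfNat.ofNat_ne_zero, one_ne_zero, and_false,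
      if_false, this, show i + 2 ≠ 1 by omega, show i + 2 - 1 = i + 1 by omega,
      show i + 2 + 1 = i + 1 + 2 by omega]
    ring

/-- If the `n`-th element vanishes, the span of the first `n` ones is stable under multiplication
by `θ`. -/
theorem adjoin_le_span_dicksonBasis (R : Type*) [CommRing R] [Algebra R A] {n : ℕ} (hn : 0 < n)
    (h0 : dicksonBasis ε θ n = 0) {x : A} (hx : x ∈ Algebra.adjoin R {θ}) :
    x ∈ Submodule.span R (Set.range fun i : Fin n => dicksonBasis ε θ i) := by
  set P := Submodule.span R (Set.range fun i : Fin n => dicksonBasis ε θ i)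
  have hb : ∀ i ≤ n, dicksonBasis ε θ i ∈ P := fun i hi => by
    rcases hi.lt_or_eq with h | rfl
    · exact Submodule.subset_span ⟨⟨i, h⟩, rfl⟩
    · rw [h0]; exact P.zero_mem
  have hmul : ∀ y ∈ P, θ * y ∈ P := fun y hy => by
    induction hy using Submodule.span_induction with
    | mem y hy =>
      obtain ⟨i, rfl⟩ := hy
      dsimp only
      rw [mul_dicksonBasis]
      refine P.add_mem (hb _ i.2) ?_
      rw [← zsmul_eq_mul]
      exact P.smul_of_tower_mem _ (hb _ ((Nat.sub_le _ _).trans i.2.le))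
    | zero => simp
    | add y z _ _ hy hz => rw [mul_add]; exact P.add_mem hy hz
    | smul c y _ hy => rw [mul_smul_comm]; exact P.smul_mem c hy
  have hpow : ∀ k : ℕ, θ ^ k ∈ P := fun k => by
    induction k with
    | zero => simpa [dicksonBasis] using hb 0 (Nat.zero_le n)
    | succ k ih => rw [pow_succ']; exact hmul _ ih
  rw [Algebra.adjoin_singleton_eq_range_aeval] at hx
  obtain ⟨p, rfl⟩ := hx
  rw [AlgHom.toRingHom_eq_coe, RingHom.coe_coe, aeval_eq_sum_range]
  exact P.sum_mem fun k _ => P.smul_mem _ (hpow k)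

end DicksonBasis

/-! ### The integers of `ℚ(ζ + ε ζ⁻¹)` -/

section QuadraticSubfield

variable {E : Type*} [Field E] {r : ℕ} {ζ : E} {ε : ℤ}

theorem isPrimitiveRoot_intCast_mul_inv (hr : 3 ≤ r) (hζ : IsPrimitiveRoot ζ (2 ^ r))
    (hε : ε = 1 ∨ ε = -1) : IsPrimitiveRoot ((ε : E) * ζ⁻¹) (2 ^ r) := by
  rcases hε with rfl | rfl
  · simpa using hζ.inv
  · have h : ((-1 : ℤ) : E) * ζ⁻¹ = ζ⁻¹ ^ (1 + 2 ^ (r - 1)) := by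
      rw [pow_add, hζ.inv.two_pow_half (by omega)]
      simp
    rw [h]
    refine hζ.inv.pow_of_coprime _ ((Nat.coprime_two_right.2 ?_).pow_right r)
    exact (Even.pow_of_ne_zero even_two (by omega)).one_add

variable {K : Type*} [Field K] [Algebra K E] {θ : 𝓞 K}

theorem algebraMap_dicksonBasis (hζ : IsPrimitiveRoot ζ (2 ^ r))
    (hθ : algebraMap K E θ = ζ + ε * ζ⁻¹) {i : ℕ} (hi : i ≠ 0) :
    algebraMap K E (dicksonBasis ε (θ : K) i) = ζ ^ i + ε ^ i * ζ⁻¹ ^ i := by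
  have h0 : ζ ≠ 0 := hζ.ne_zero (by positivity)
  rw [map_dicksonBasis, hθ, dicksonBasis, if_neg hi,
    aeval_dickson_eq_add ε _ rfl (by field_simp), mul_pow]

/-- The power `ζ ^ 2 ^ (r - 2)` is a square root of `-1`, hence the negative of its inverse; the
exponent is even, so the sign `ε` plays no role. -/
theorem dicksonBasis_eq_zero (hr : 3 ≤ r) (hζ : IsPrimitiveRoot ζ (2 ^ r))
    (hε : ε = 1 ∨ ε = -1) (hθ : algebraMap K E θ = ζ + ε * ζ⁻¹) :
    dicksonBasis ε (θ : K) (2 ^ (r - 2)) = 0 := by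
  have h0 : ζ ≠ 0 := hζ.ne_zero (by positivity)
  refine (algebraMap K E).injective ?_
  have heven : Even (2 ^ (r - 2)) := Even.pow_of_ne_zero even_two (by omega)
  have h1 : (ε : E) ^ 2 ^ (r - 2) = 1 := by
    rcases hε with rfl | rfl
    · simp
    · simpa using heven.neg_one_pow
  have h2 : ζ ^ 2 ^ (r - 2) * ζ ^ 2 ^ (r - 2) = -1 := by
    rw [← pow_add, ← two_mul, ← pow_succ', show r - 2 + 1 = r - 1 by omega,
      hζ.two_pow_half (by omega)]
  rw [algebraMap_dicksonBasis hζ hθ (by positivity), h1, map_zero, inv_pow]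
  field_simp
  linear_combination h2

variable [NumberField K]

theorem span_rat_dicksonBasis (hr : 3 ≤ r) (hζ : IsPrimitiveRoot ζ (2 ^ r))
    (hε : ε = 1 ∨ ε = -1) (hθ : algebraMap K E θ = ζ + ε * ζ⁻¹)
    (hK : Algebra.adjoin ℚ {(θ : K)} = ⊤) :
    ⊤ ≤ Submodule.span ℚ
      (Set.range fun i : Fin (2 ^ (r - 2)) => ((dicksonBasis ε θ i : 𝓞 K) : K)) := by
  intro x _
  have hx : x ∈ Algebra.adjoin ℚ {(θ : K)} := hK ▸ Algebra.mem_top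
  have := adjoin_le_span_dicksonBasis ε (θ : K) ℚ (by positivity)
    (dicksonBasis_eq_zero hr hζ hε hθ) hx
  simpa only [map_dicksonBasis] using this

variable [NumberField E] [IsCyclotomicExtension {2 ^ r} ℚ E]

theorem finrank_le_two (hζ : IsPrimitiveRoot ζ (2 ^ r))
    (hθ : algebraMap K E θ = ζ + ε * ζ⁻¹) : Module.finrank K E ≤ 2 := by
  have h0 : ζ ≠ 0 := hζ.ne_zero (by positivity)
  have htop : ⊤ ≤ Submodule.span K (Set.range ![(1 : E), ζ]) := by
    intro x _
    have hx : x ∈ Algebra.adjoin K {ζ} := by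
      have : x ∈ Algebra.adjoin ℚ {ζ} := by
        rw [IsCyclotomicExtension.adjoin_primitive_root_eq_top hζ]
        exact Algebra.mem_top
      exact Algebra.adjoin_le (S := (Algebra.adjoin K {ζ}).restrictScalars ℚ)
        (Algebra.subset_adjoin (R := K)) this
    obtain ⟨a, ⟨a, rfl⟩, b, ⟨b, rfl⟩, rfl⟩ := exists_add_mul_of_mem_adjoin (S := ⊥)
      (Algebra.mem_bot.2 ⟨(θ : K), rfl⟩) (Algebra.mem_bot.2 ⟨-(ε : K), rfl⟩)
      (by rw [hθ]; simp; field_simp; ring) hx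
    rw [Submodule.mem_span_range_iff_exists_fun]
    exact ⟨![a, b], by simp [Fin.sum_univ_two, Algebra.smul_def]⟩
  have := finrank_range_le_card (R := K) (b := ![(1 : E), ζ])
  rw [Set.finrank, top_le_iff.1 htop, finrank_top] at this
  simpa using this

theorem finrank_mul_finrank_eq (hr : 3 ≤ r) :
    Module.finrank ℚ K * Module.finrank K E = 2 ^ (r - 2) * 2 := by
  rw [Module.finrank_mul_finrank ℚ K E, finrank_eq_two_pow (r := r) (by omega), ← pow_succ]
  congr 1
  omega

/-- Two upper bounds, for `[K : ℚ]` and for `[E : K]`, whose product is the degree of `E`. -/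
theorem finrank_rat_eq (hr : 3 ≤ r) (hζ : IsPrimitiveRoot ζ (2 ^ r))
    (hε : ε = 1 ∨ ε = -1) (hθ : algebraMap K E θ = ζ + ε * ζ⁻¹)
    (hK : Algebra.adjoin ℚ {(θ : K)} = ⊤) : Module.finrank ℚ K = 2 ^ (r - 2) := by
  have h1 := finrank_le_two hζ hθ
  have h2 : Module.finrank ℚ K ≤ 2 ^ (r - 2) := by
    have := finrank_range_le_card (R := ℚ)
      (b := fun i : Fin (2 ^ (r - 2)) => ((dicksonBasis ε θ i : 𝓞 K) : K))
    rwa [Set.finrank, top_le_iff.1 (span_rat_dicksonBasis hr hζ hε hθ hK), finrank_top,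
      Fintype.card_fin] at this
  have h3 := finrank_mul_finrank_eq (K := K) (E := E) hr
  nlinarith

theorem finrank_eq_two (hr : 3 ≤ r) (hζ : IsPrimitiveRoot ζ (2 ^ r))
    (hε : ε = 1 ∨ ε = -1) (hθ : algebraMap K E θ = ζ + ε * ζ⁻¹)
    (hK : Algebra.adjoin ℚ {(θ : K)} = ⊤) : Module.finrank K E = 2 := by
  have h3 := finrank_mul_finrank_eq (K := K) (E := E) hr
  rw [finrank_rat_eq hr hζ hε hθ hK] at h3
  exact Nat.eq_of_mul_eq_mul_left (by positivity) h3

theorem two_mul_trace (hr : 3 ≤ r) (hζ : IsPrimitiveRoot ζ (2 ^ r))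
    (hε : ε = 1 ∨ ε = -1) (hθ : algebraMap K E θ = ζ + ε * ζ⁻¹)
    (hK : Algebra.adjoin ℚ {(θ : K)} = ⊤) (x : K) :
    2 * Algebra.trace ℚ K x = Algebra.trace ℚ E (algebraMap K E x) := by
  rw [← Algebra.trace_trace (S := K) (x := algebraMap K E x), Algebra.trace_algebraMap,
    finrank_eq_two hr hζ hε hθ hK, map_nsmul, nsmul_eq_mul]
  simp

/-- The ring of integers of `ℚ(θ)` is `ℤ[θ]`: it consists of the elements of `ℤ[ζ]` fixed by `ζ ↦
ε ζ⁻¹`. -/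
theorem span_int_dicksonBasis (hr : 3 ≤ r) (hζ : IsPrimitiveRoot ζ (2 ^ r))
    (hε : ε = 1 ∨ ε = -1) (hθ : algebraMap K E θ = ζ + ε * ζ⁻¹)
    (hK : Algebra.adjoin ℚ {(θ : K)} = ⊤) :
    ⊤ ≤ Submodule.span ℤ
      (Set.range fun i : Fin (2 ^ (r - 2)) => (dicksonBasis ε θ i : 𝓞 K)) := by
  have h0 : ζ ≠ 0 := hζ.ne_zero (by positivity)
  intro x _
  refine adjoin_le_span_dicksonBasis ε θ ℤ (by positivity) (RingOfIntegers.coe_injective ?_) ?_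
  · have := dicksonBasis_eq_zero hr hζ hε hθ
    rw [map_zero, map_dicksonBasis, this]
  let f : 𝓞 K →ₐ[ℤ] E := ((algebraMap K E).comp (algebraMap (𝓞 K) K)).toIntAlgHom
  have hf : Function.Injective f :=
    (algebraMap K E).injective.comp RingOfIntegers.coe_injective
  have hfθ : f θ = ζ + ε * ζ⁻¹ := hθ
  obtain ⟨σ, hσ⟩ := exists_algEquiv_apply_eq hζ (isPrimitiveRoot_intCast_mul_inv hr hζ hε)
  have hσinv : σ ζ⁻¹ = ε * ζ := by
    rw [map_inv₀, hσ, mul_inv, inv_inv]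
    rcases hε with rfl | rfl <;> simp
  have hσθ : σ (ζ + ε * ζ⁻¹) = ζ + ε * ζ⁻¹ := by
    rw [map_add, map_mul, hσ, hσinv, map_intCast, ← mul_assoc]
    rcases hε with rfl | rfl <;> simp <;> ring
  have hfix : ∀ y : K, σ (algebraMap K E y) = algebraMap K E y := by
    have h1 : (σ : E →ₐ[ℚ] E).comp (IsScalarTower.toAlgHom ℚ K E) =
        IsScalarTower.toAlgHom ℚ K E := by
      refine AlgHom.ext_of_adjoin_eq_top hK ?_
      rintro _ rfl
      simp [hθ, hσθ]
    exact fun y => DFunLike.congr_fun h1 y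
  have hmem : f x ∈ Algebra.adjoin ℤ {ζ} := by
    have : IsIntegralClosure (Algebra.adjoin ℤ {ζ}) ℤ E :=
      IsCyclotomicExtension.Rat.isIntegralClosure_adjoin_singleton_of_prime_pow (p := 2) hζ
    have hint : IsIntegral ℤ (f x) := (RingOfIntegers.isIntegral x).map f
    obtain ⟨y, hy⟩ := (IsIntegralClosure.isIntegral_iff (A := Algebra.adjoin ℤ {ζ})).1 hint
    rw [← hy]
    exact y.2
  have hσζ : σ ζ ≠ ζ := by
    rw [hσ]
    intro h
    have h1 : ζ ^ 2 = ε := by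
      field_simp at h
      exact h.symm
    have h2 : ζ ^ 4 = 1 := by
      rw [show 4 = 2 * 2 from rfl, pow_mul, h1]
      rcases hε with rfl | rfl <;> simp
    have h3 := Nat.le_of_dvd (by norm_num) (hζ.dvd_of_pow_eq_one _ h2)
    have h4 : 2 ^ 3 ≤ 2 ^ r := Nat.pow_le_pow_right (by norm_num) hr
    omega
  have hS := mem_of_fixed_of_mem_adjoin (S := Algebra.adjoin ℤ {f θ}) (p := f θ)
    (q := -(ε : E)) (σ := σ) (Algebra.self_mem_adjoin_singleton ℤ _)
    (neg_mem (intCast_mem _ ε)) (by rw [hfθ]; field_simp; ring)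
    (fun s hs => by
      rw [← Set.image_singleton, ← AlgHom.map_adjoin] at hs
      obtain ⟨y, -, rfl⟩ := hs
      exact hfix y) hσζ hmem (hfix x)
  rw [← Set.image_singleton, ← AlgHom.map_adjoin] at hS
  obtain ⟨y, hy, hyx⟩ := hS
  rwa [← hf hyx]

end QuadraticSubfield

/-! ### Trace form and discriminant -/

section Gram

variable {E : Type*} [Field E] [NumberField E] {r : ℕ} [IsCyclotomicExtension {2 ^ r} ℚ E]
  {ζ : E} {ε : ℤ}

theorem trace_intCast_mul_zpow (hr : 1 ≤ r) (hζ : IsPrimitiveRoot ζ (2 ^ r)) (c : ℤ) {k : ℤ}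
    (hk : |k| < 2 ^ (r - 1)) :
    Algebra.trace ℚ E (c * ζ ^ k) = if k = 0 then (c : ℚ) * 2 ^ (r - 1) else 0 := by
  rw [← zsmul_eq_mul, map_zsmul, trace_zpow hr hζ hk, zsmul_eq_mul, mul_ite, mul_zero]

variable {K : Type*} [Field K] [NumberField K] [Algebra K E] {θ : 𝓞 K}

theorem trace_dicksonBasis (hr : 3 ≤ r) (hζ : IsPrimitiveRoot ζ (2 ^ r))
    (hε : ε = 1 ∨ ε = -1) (hθ : algebraMap K E θ = ζ + ε * ζ⁻¹)
    (hK : Algebra.adjoin ℚ {(θ : K)} = ⊤) {i : ℕ} (hi : i ≠ 0) (hin : i < 2 ^ (r - 2)) :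
    Algebra.trace ℚ K (dicksonBasis ε (θ : K) i) = 0 := by
  have hpow : 2 ^ (r - 1) = 2 * 2 ^ (r - 2) := by
    rw [← pow_succ', show r - 2 + 1 = r - 1 by omega]
  have h2 : ((2 ^ (r - 1) : ℕ) : ℤ) = 2 * (2 ^ (r - 2) : ℕ) := by exact_mod_cast hpow
  push_cast at h2
  zify at hin hi
  have h := two_mul_trace hr hζ hε hθ hK (dicksonBasis ε (θ : K) i)
  have h1 : algebraMap K E (dicksonBasis ε (θ : K) i) =
      ((1 : ℤ) : E) * ζ ^ (i : ℤ) + ((ε ^ i : ℤ) : E) * ζ ^ (-(i : ℤ)) := by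
    rw [algebraMap_dicksonBasis hζ hθ (by exact_mod_cast hi)]
    simp
  rw [h1, map_add, trace_intCast_mul_zpow (by omega) hζ _ (by rw [abs_lt]; omega),
    trace_intCast_mul_zpow (by omega) hζ _ (by rw [abs_lt]; omega), if_neg (by omega),
    if_neg (by omega)] at h
  linarith

theorem trace_dicksonBasis_mul (hr : 3 ≤ r) (hζ : IsPrimitiveRoot ζ (2 ^ r))
    (hε : ε = 1 ∨ ε = -1) (hθ : algebraMap K E θ = ζ + ε * ζ⁻¹)
    (hK : Algebra.adjoin ℚ {(θ : K)} = ⊤) {i j : ℕ} (hi : i < 2 ^ (r - 2))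
    (hj : j < 2 ^ (r - 2)) :
    Algebra.trace ℚ K (dicksonBasis ε (θ : K) i * dicksonBasis ε (θ : K) j) =
      if i = j then (ε : ℚ) ^ j * (if i = 0 then 2 ^ (r - 2) else 2 * 2 ^ (r - 2)) else 0 := by
  rcases eq_or_ne i 0 with rfl | hi0
  · rw [show dicksonBasis ε (θ : K) 0 = 1 from if_pos rfl, one_mul]
    rcases eq_or_ne j 0 with rfl | hj0
    · rw [show dicksonBasis ε (θ : K) 0 = 1 from if_pos rfl, ← map_one (algebraMap ℚ K),
        Algebra.trace_algebraMap, finrank_rat_eq hr hζ hε hθ hK]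
      simp
    · rw [trace_dicksonBasis hr hζ hε hθ hK hj0 hj, if_neg hj0.symm]
  rcases eq_or_ne j 0 with rfl | hj0
  · rw [show dicksonBasis ε (θ : K) 0 = 1 from if_pos rfl, mul_one,
      trace_dicksonBasis hr hζ hε hθ hK hi0 hi, if_neg hi0]
  have h0 : ζ ≠ 0 := hζ.ne_zero (by positivity)
  have hpow : 2 ^ (r - 1) = 2 * 2 ^ (r - 2) := by
    rw [← pow_succ', show r - 2 + 1 = r - 1 by omega]
  have h2 : ((2 ^ (r - 1) : ℕ) : ℤ) = 2 * (2 ^ (r - 2) : ℕ) := by exact_mod_cast hpow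
  have h2' : (2 : ℚ) ^ (r - 1) = 2 * 2 ^ (r - 2) := by exact_mod_cast hpow
  push_cast at h2
  have hi' : (i : ℤ) < 2 ^ (r - 2) := by exact_mod_cast hi
  have hj' : (j : ℤ) < 2 ^ (r - 2) := by exact_mod_cast hj
  have h := two_mul_trace hr hζ hε hθ hK (dicksonBasis ε (θ : K) i * dicksonBasis ε (θ : K) j)
  have h1 : algebraMap K E (dicksonBasis ε (θ : K) i * dicksonBasis ε (θ : K) j) =
      ((1 : ℤ) : E) * ζ ^ (i + j : ℤ) + ((ε ^ i * ε ^ j : ℤ) : E) * ζ ^ (-(i + j) : ℤ) +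
      (((ε ^ j : ℤ) : E) * ζ ^ (i - j : ℤ) + ((ε ^ i : ℤ) : E) * ζ ^ (j - i : ℤ)) := by
    rw [map_mul, algebraMap_dicksonBasis hζ hθ hi0, algebraMap_dicksonBasis hζ hθ hj0, neg_add]
    simp only [zpow_add₀ h0, zpow_sub₀ h0, zpow_neg, zpow_natCast, inv_pow]
    push_cast
    field_simp
    ring
  rw [h1, map_add, map_add, map_add, trace_intCast_mul_zpow (by omega) hζ _ (by rw [abs_lt]; omega),
    trace_intCast_mul_zpow (by omega) hζ _ (by rw [abs_lt]; omega),
    trace_intCast_mul_zpow (by omega) hζ _ (by rw [abs_lt]; omega),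
    trace_intCast_mul_zpow (by omega) hζ _ (by rw [abs_lt]; omega), if_neg (by omega),
    if_neg (by omega)] at h
  rcases eq_or_ne i j with rfl | hij
  · rw [if_pos (by omega), h2'] at h
    rw [if_pos rfl, if_neg hi0]
    push_cast at h
    linarith
  · rw [if_neg (by omega), if_neg (by omega)] at h
    rw [if_neg hij]
    linarith

theorem exists_basis_dicksonBasis (hr : 3 ≤ r) (hζ : IsPrimitiveRoot ζ (2 ^ r))
    (hε : ε = 1 ∨ ε = -1) (hθ : algebraMap K E θ = ζ + ε * ζ⁻¹)
    (hK : Algebra.adjoin ℚ {(θ : K)} = ⊤) :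
    ∃ b : Module.Basis (Fin (2 ^ (r - 2))) ℤ (𝓞 K), ∀ i, b i = dicksonBasis ε θ i := by
  have hli : LinearIndependent ℤ fun i : Fin (2 ^ (r - 2)) => (dicksonBasis ε θ i : 𝓞 K) := by
    refine linearIndependent_of_top_le_span_of_card_le_finrank
      (span_int_dicksonBasis hr hζ hε hθ hK) ?_
    rw [RingOfIntegers.rank, finrank_rat_eq hr hζ hε hθ hK, Fintype.card_fin]
  exact ⟨Module.Basis.mk hli (span_int_dicksonBasis hr hζ hε hθ hK), fun i => by simp⟩

/-- The trace form `Tr (x y)` is diagonal in the integral basis, the entries being those of the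
positive definite form `Tr (x τ(y))` up to sign. -/
theorem abs_discr_eq (hr : 3 ≤ r) (hζ : IsPrimitiveRoot ζ (2 ^ r))
    (hε : ε = 1 ∨ ε = -1) (hθ : algebraMap K E θ = ζ + ε * ζ⁻¹)
    (hK : Algebra.adjoin ℚ {(θ : K)} = ⊤) :
    |discr K| = (2 ^ (r - 2) : ℤ) ^ 2 ^ (r - 2) * 2 ^ (2 ^ (r - 2) - 1) := by
  obtain ⟨b, hb⟩ := exists_basis_dicksonBasis hr hζ hε hθ hK
  have hmat : (Algebra.traceMatrix ℤ b).map (Int.castRingHom ℚ) =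
      Matrix.diagonal fun i : Fin (2 ^ (r - 2)) =>
        (ε : ℚ) ^ (i : ℕ) * (if (i : ℕ) = 0 then 2 ^ (r - 2) else 2 * 2 ^ (r - 2)) := by
    ext i j
    have h := trace_dicksonBasis_mul hr hζ hε hθ hK i.2 j.2
    rw [Matrix.map_apply, Algebra.traceMatrix_apply, Algebra.traceForm_apply, hb, hb,
      eq_intCast, ← eq_intCast (algebraMap ℤ ℚ),
      ← Algebra.trace_localization ℤ (nonZeroDivisors ℤ) (Rₘ := ℚ) (Sₘ := K), map_mul,
      map_dicksonBasis, map_dicksonBasis, h, Matrix.diagonal_apply]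
    simp only [Fin.ext_iff]
    split_ifs with h1 <;> simp [h1]
  have hdet : ((discr K : ℤ) : ℚ) = ∏ i : Fin (2 ^ (r - 2)),
        (ε : ℚ) ^ (i : ℕ) * (if (i : ℕ) = 0 then 2 ^ (r - 2) else 2 * 2 ^ (r - 2)) := by
    rw [← discr_eq_discr K b, Algebra.discr_def, ← Matrix.det_diagonal, ← hmat,
      ← RingHom.mapMatrix_apply, ← RingHom.map_det, eq_intCast]
  have habs : ((|discr K| : ℤ) : ℚ) =
      (2 ^ (r - 2) : ℚ) ^ 2 ^ (r - 2) * 2 ^ (2 ^ (r - 2) - 1) := by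
    rw [Int.cast_abs, hdet, Finset.abs_prod]
    have h1 : ∀ i : ℕ, |(ε : ℚ) ^ i * (if i = 0 then 2 ^ (r - 2) else 2 * 2 ^ (r - 2))| =
        2 ^ (r - 2) * if i = 0 then 1 else 2 := fun i => by
      have : |(ε : ℚ)| = 1 := by rcases hε with rfl | rfl <;> simp
      rw [abs_mul, abs_pow, this, one_pow, one_mul]
      split_ifs <;> simp [mul_comm]
    obtain ⟨m, hm⟩ : ∃ m, 2 ^ (r - 2) = m + 1 := Nat.exists_eq_succ_of_ne_zero (by positivity)
    simp_rw [h1]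
    rw [Finset.prod_mul_distrib, Finset.prod_const,
      Finset.card_univ, Fintype.card_fin, hm, Fin.prod_univ_succ]
    simp
  exact_mod_cast habs

end Gram

/-! ### Complex conjugation -/

section Conjugation

variable {E : Type*} [Field E] {r : ℕ} {ζ : E}

theorem star_apply_eq_apply_inv (hζ : IsPrimitiveRoot ζ (2 ^ r)) (ψ : E →+* ℂ) :
    starRingEnd ℂ (ψ ζ) = ψ ζ⁻¹ := by
  rw [map_inv₀, Complex.inv_eq_conj]
  exact (hζ.map_of_injective ψ.injective).norm'_eq_one (by positivity)

variable [NumberField E] [IsCyclotomicExtension {2 ^ r} ℚ E]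

theorem isComplexConjugation_of_apply_eq_inv (hζ : IsPrimitiveRoot ζ (2 ^ r)) {c : E ≃ₐ[ℚ] E}
    (hc : c ζ = ζ⁻¹) : IsComplexConjugation (c : E ≃+* E) := by
  intro ψ x
  have h : (ψ.toRatAlgHom).comp (c : E →ₐ[ℚ] E) =
      ((starRingEnd ℂ).comp ψ).toRatAlgHom := by
    refine AlgHom.ext_of_adjoin_eq_top
      (IsCyclotomicExtension.adjoin_primitive_root_eq_top hζ) ?_
    rintro _ rfl
    simp [hc, star_apply_eq_apply_inv hζ]
  exact DFunLike.congr_fun h x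

variable {K : Type*} [Field K] [NumberField K] [Algebra K E] {ε : ℤ} {θ : 𝓞 K}

/-- The restriction to `K` of the automorphism `ζ ↦ ζ⁻¹` of `E`. -/
theorem exists_isComplexConjugation [Normal ℚ K] (hζ : IsPrimitiveRoot ζ (2 ^ r))
    (hε : ε = 1 ∨ ε = -1) (hθ : algebraMap K E θ = ζ + ε * ζ⁻¹) :
    ∃ τ : K ≃+* K, IsComplexConjugation τ ∧
      ∀ i, τ (dicksonBasis ε (θ : K) i) = ε ^ i * dicksonBasis ε (θ : K) i := by
  obtain ⟨c, hc⟩ := exists_algEquiv_apply_eq hζ hζ.inv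
  have hτ : ∀ x, algebraMap K E (c.restrictNormal K x) = c (algebraMap K E x) :=
    c.restrictNormal_commutes K
  refine ⟨(c.restrictNormal K : K ≃+* K), fun φ x => ?_, fun i => ?_⟩
  · let ψ := ComplexEmbedding.lift E φ
    have hψ : ∀ y, ψ (algebraMap K E y) = φ y := ComplexEmbedding.lift_algebraMap_apply E φ
    rw [← hψ, ← hψ]
    refine Eq.trans ?_ (isComplexConjugation_of_apply_eq_inv hζ hc ψ _)
    exact congrArg ψ (hτ x)
  · refine (algebraMap K E).injective ((hτ _).trans ?_)
    rcases eq_or_ne i 0 with rfl | hi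
    · simp [dicksonBasis]
    · have h1 : (ε : E) ^ i * ε ^ i = 1 := by
        rw [← mul_pow]
        rcases hε with rfl | rfl <;> simp
      rw [map_mul, map_pow, map_intCast, algebraMap_dicksonBasis hζ hθ hi]
      simp only [map_add, map_mul, map_pow, map_inv₀, hc, map_intCast, inv_inv]
      linear_combination (-ζ⁻¹ ^ i) * h1

theorem trace_dicksonBasis_mul_conj (hr : 3 ≤ r) (hζ : IsPrimitiveRoot ζ (2 ^ r))
    (hε : ε = 1 ∨ ε = -1) (hθ : algebraMap K E θ = ζ + ε * ζ⁻¹)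
    (hK : Algebra.adjoin ℚ {(θ : K)} = ⊤) {τ : K ≃+* K}
    (hτ : ∀ i, τ (dicksonBasis ε (θ : K) i) = ε ^ i * dicksonBasis ε (θ : K) i) {i j : ℕ}
    (hi : i < 2 ^ (r - 2)) (hj : j < 2 ^ (r - 2)) :
    Algebra.trace ℚ K (dicksonBasis ε (θ : K) i * τ (dicksonBasis ε (θ : K) j)) =
      if i = j then (if i = 0 then 2 ^ (r - 2) else 2 * 2 ^ (r - 2)) else 0 := by
  have h1 : (ε : ℚ) ^ j * ε ^ j = 1 := by
    rw [← mul_pow]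
    rcases hε with rfl | rfl <;> simp
  rw [hτ, mul_left_comm, ← Int.cast_pow, ← zsmul_eq_mul, map_zsmul,
    trace_dicksonBasis_mul hr hζ hε hθ hK hi hj, zsmul_eq_mul, Int.cast_pow, mul_ite, mul_zero,
    ← mul_assoc, h1, one_mul]

end Conjugation

/-! ### Bounds from the unweighted trace form -/

section Bound

variable {E : Type*} [Field E] [NumberField E] {r : ℕ} [IsCyclotomicExtension {2 ^ r} ℚ E]
  {ζ : E}

theorem euclideanMinimum_cyclotomic_le (hr : 3 ≤ r) (hζ : IsPrimitiveRoot ζ (2 ^ r)) :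
    euclideanMinimum E ≤
      ((((2 : ℝ) ^ Module.finrank ℚ E)⁻¹ * √|(discr E : ℝ)| : ℝ) : EReal) := by
  have h0 : ζ ≠ 0 := hζ.ne_zero (by positivity)
  have hζ' : ((hζ.toInteger : 𝓞 E) : E) = ζ := hζ.coe_toInteger
  have hn := finrank_eq_two_pow (E := E) (r := r) (by omega)
  obtain ⟨c, hc⟩ := exists_algEquiv_apply_eq hζ hζ.inv
  have hspan : ⊤ ≤ Submodule.span ℚ
      (Set.range fun i : Fin (2 ^ (r - 1)) => ((hζ.toInteger ^ (i : ℕ) : 𝓞 E) : E)) := by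
    have h1 := (hζ.powerBasis ℚ).basis.span_eq
    rw [← h1, Submodule.span_le]
    rintro _ ⟨i, rfl⟩
    refine Submodule.subset_span ⟨⟨i, ?_⟩, ?_⟩
    · rw [← hn, PowerBasis.finrank (hζ.powerBasis ℚ)]
      exact i.2
    · simp [hζ']
  have hdisc : |(discr E : ℝ)| = (2 ^ (r - 1) : ℝ) ^ 2 ^ (r - 1) := by
    have h3 := IsCyclotomicExtension.Rat.discr_prime_pow 2 r E
    rw [h3]
    push_cast
    rw [abs_mul, abs_pow, abs_neg, abs_one, one_pow, one_mul, abs_of_pos (by positivity),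
      ← pow_mul, mul_comm (r - 1)]
    simp
  refine euclideanMinimum_le fun x => ?_
  obtain ⟨y, hy⟩ := exists_abs_norm_mul_norm_sub_sq_le
    (isComplexConjugation_of_apply_eq_inv hζ hc) (α := 1) (by simp) hspan
    (d := fun _ => 2 ^ (r - 1)) (fun _ => by positivity) (fun i j => by
      have h3 : (1 : E) * (((hζ.toInteger ^ (i : ℕ) : 𝓞 E) : E) *
          (c : E ≃+* E) ((hζ.toInteger ^ (j : ℕ) : 𝓞 E) : E)) = ζ ^ ((i : ℤ) - j) := by
        simp [hζ', hc, zpow_sub₀ h0, div_eq_mul_inv]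
      have hi := i.2
      have hj := j.2
      zify at hi hj
      rw [h3, trace_zpow (by omega) hζ (by rw [abs_lt]; omega)]
      simp only [sub_eq_zero, Nat.cast_inj, Fin.ext_iff]) x
  refine ⟨y, abs_le_inv_two_pow_mul_sqrt ?_⟩
  rw [hn] at hy ⊢
  rw [hdisc]
  have h4 : ((∑ _i : Fin (2 ^ (r - 1)), (2 : ℚ) ^ (r - 1)) / (4 * (2 ^ (r - 1) : ℕ))) =
      2 ^ (r - 1) / 4 := by
    simp
    field_simp
  rw [h4, map_one, abs_one, one_mul, div_pow, le_div_iff₀ (by positivity)] at hy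
  exact_mod_cast hy

variable {K : Type*} [Field K] [NumberField K] [Algebra K E] {θ : 𝓞 K}

theorem euclideanMinimum_skew_le [Normal ℚ K] (hr : 3 ≤ r) (hζ : IsPrimitiveRoot ζ (2 ^ r))
    (hθ : algebraMap K E θ = ζ + (-1 : ℤ) * ζ⁻¹) (hK : Algebra.adjoin ℚ {(θ : K)} = ⊤) :
    euclideanMinimum K ≤ ((((2 : ℝ) ^ Module.finrank ℚ K)⁻¹ *
      (2 * (Module.finrank ℚ K : ℝ) - 1) ^ ((Module.finrank ℚ K : ℝ) / 2) : ℝ) : EReal) := by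
  have hε : (-1 : ℤ) = 1 ∨ (-1 : ℤ) = -1 := Or.inr rfl
  have hn := finrank_rat_eq hr hζ hε hθ hK
  obtain ⟨τ, hτ, hτb⟩ := exists_isComplexConjugation hζ hε hθ
  refine euclideanMinimum_le fun x => ?_
  obtain ⟨y, hy⟩ := exists_abs_norm_mul_norm_sub_sq_le hτ (α := 1) (by simp)
    (span_rat_dicksonBasis hr hζ hε hθ hK)
    (d := fun i => if (i : ℕ) = 0 then 2 ^ (r - 2) else 2 * 2 ^ (r - 2))
    (fun _ => by positivity) (fun i j => by
      simp only [one_mul, map_dicksonBasis]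
      rw [trace_dicksonBasis_mul_conj hr hζ hε hθ hK hτb i.2 j.2]
      simp only [Fin.ext_iff]) x
  have hpos : (0 : ℝ) ≤ 2 * (Module.finrank ℚ K : ℝ) - 1 := by
    have : (1 : ℝ) ≤ Module.finrank ℚ K := by exact_mod_cast Module.finrank_pos
    linarith
  refine ⟨y, ?_⟩
  have hsqrt : (2 * (Module.finrank ℚ K : ℝ) - 1) ^ ((Module.finrank ℚ K : ℝ) / 2) =
      √((2 * (Module.finrank ℚ K : ℝ) - 1) ^ Module.finrank ℚ K) := by
    rw [Real.sqrt_eq_rpow, ← Real.rpow_natCast, ← Real.rpow_mul hpos, mul_one_div]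
  rw [hsqrt]
  refine abs_le_inv_two_pow_mul_sqrt ?_
  rw [hn] at hy ⊢
  -- The squares `n, 2n, …, 2n` have the sum `n (2n - 1)`.
  have h4 : (∑ i : Fin (2 ^ (r - 2)), if (i : ℕ) = 0 then (2 : ℚ) ^ (r - 2) else
      2 * 2 ^ (r - 2)) / (4 * (2 ^ (r - 2) : ℕ)) = (2 * 2 ^ (r - 2) - 1) / 4 := by
    obtain ⟨m, hm⟩ : ∃ m, 2 ^ (r - 2) = m + 1 := Nat.exists_eq_succ_of_ne_zero (by positivity)
    have hm' : (2 : ℚ) ^ (r - 2) = m + 1 := by exact_mod_cast hm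
    have : (m : ℚ) + 1 ≠ 0 := by positivity
    rw [hm', hm, Fin.sum_univ_succ]
    simp
    field_simp
    ring
  rw [h4, map_one, abs_one, one_mul, div_pow, le_div_iff₀ (by positivity)] at hy
  exact_mod_cast hy

end Bound

/-! ### The bound for the real subfield -/

section RealSubfield

variable {E : Type*} [Field E] {r : ℕ} {ζ : E}
  {K : Type*} [Field K] [Algebra K E] {θ : 𝓞 K}

theorem algebraMap_two_sub (hζ : IsPrimitiveRoot ζ (2 ^ r))
    (hθ : algebraMap K E θ = ζ + (1 : ℤ) * ζ⁻¹) :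
    algebraMap K E (2 - θ) = -ζ⁻¹ * (ζ - 1) ^ 2 := by
  have h0 : ζ ≠ 0 := hζ.ne_zero (by positivity)
  rw [map_sub, map_ofNat, hθ]
  push_cast
  field_simp
  ring

/-- The partial sum is `ζ ^ (-i) + ⋯ + ζ ^ i`, a geometric series. -/
theorem sum_dicksonBasis_mul (hζ : IsPrimitiveRoot ζ (2 ^ r))
    (hθ : algebraMap K E θ = ζ + (1 : ℤ) * ζ⁻¹) (i : ℕ) :
    algebraMap K E (∑ k ∈ Finset.range (i + 1), dicksonBasis 1 (θ : K) k) * (ζ - 1) =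
      ζ ^ (i + 1) - ζ⁻¹ ^ i := by
  have h0 : ζ ≠ 0 := hζ.ne_zero (by positivity)
  induction i with
  | zero => simp [dicksonBasis]
  | succ i ih =>
    rw [Finset.sum_range_succ, map_add, add_mul, ih, algebraMap_dicksonBasis hζ hθ (by omega)]
    simp only [inv_pow]
    push_cast
    field_simp
    ring

variable [NumberField K]

theorem span_sum_dicksonBasis (hr : 3 ≤ r) (hζ : IsPrimitiveRoot ζ (2 ^ r))
    (hθ : algebraMap K E θ = ζ + (1 : ℤ) * ζ⁻¹) (hK : Algebra.adjoin ℚ {(θ : K)} = ⊤) :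
    ⊤ ≤ Submodule.span ℚ (Set.range fun i : Fin (2 ^ (r - 2)) =>
      ((∑ k ∈ Finset.range (i + 1), dicksonBasis 1 θ k : 𝓞 K) : K)) := by
  refine (span_rat_dicksonBasis hr hζ (Or.inl rfl) hθ hK).trans (Submodule.span_le.2 ?_)
  rintro _ ⟨⟨i, hi⟩, rfl⟩
  have hmem : ∀ i < 2 ^ (r - 2), ((∑ k ∈ Finset.range (i + 1), dicksonBasis 1 θ k : 𝓞 K) : K) ∈
      Submodule.span ℚ (Set.range fun i : Fin (2 ^ (r - 2)) =>
        ((∑ k ∈ Finset.range (i + 1), dicksonBasis 1 θ k : 𝓞 K) : K)) :=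
    fun i hi => Submodule.subset_span ⟨⟨i, hi⟩, rfl⟩
  cases i with
  | zero => simpa using hmem 0 hi
  | succ i =>
    have h := Submodule.sub_mem _ (hmem (i + 1) hi) (hmem i (by omega))
    simp only [Finset.sum_range_succ _ (i + 1), map_add, add_sub_cancel_left] at h
    exact h

variable [NumberField E]

theorem apply_two_sub_eq_norm (hζ : IsPrimitiveRoot ζ (2 ^ r))
    (hθ : algebraMap K E θ = ζ + (1 : ℤ) * ζ⁻¹) (φ : K →+* ℂ) :
    φ (2 - θ) = (‖φ (2 - θ)‖ : ℂ) := by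
  have h0 : ζ ≠ 0 := hζ.ne_zero (by positivity)
  let ψ := ComplexEmbedding.lift E φ
  have h : φ (2 - θ) = ((Complex.normSq (ψ (ζ - 1)) : ℝ) : ℂ) := by
    rw [← Complex.mul_conj, map_sub ψ, map_sub (starRingEnd ℂ), star_apply_eq_apply_inv hζ,
      map_one, map_one, ← ComplexEmbedding.lift_algebraMap_apply E φ, algebraMap_two_sub hζ hθ,
      ← map_one ψ, ← map_sub, ← map_sub, ← map_mul]
    congr 1
    field_simp
    ring
  rw [h, Complex.norm_real, Real.norm_of_nonneg (Complex.normSq_nonneg _)]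

variable [IsCyclotomicExtension {2 ^ r} ℚ E]

/-- In `E` the element `2 - θ` is a root of unity times `(ζ - 1) ^ 2`, and `ζ - 1` has norm `2`.
-/
theorem abs_norm_two_sub (hr : 3 ≤ r) (hζ : IsPrimitiveRoot ζ (2 ^ r))
    (hθ : algebraMap K E θ = ζ + (1 : ℤ) * ζ⁻¹) (hK : Algebra.adjoin ℚ {(θ : K)} = ⊤) :
    |Algebra.norm ℚ (2 - (θ : K))| = 2 := by
  have h1 : Algebra.norm ℚ (algebraMap K E (2 - θ)) = Algebra.norm ℚ (2 - (θ : K)) ^ 2 := by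
    rw [← Algebra.norm_norm (S := K), Algebra.norm_algebraMap,
      finrank_eq_two hr hζ (Or.inl rfl) hθ hK, map_pow]
  have h2 : |Algebra.norm ℚ (-ζ⁻¹)| = 1 := by
    have : (-ζ⁻¹) ^ 2 ^ r = 1 := by
      rw [Even.neg_pow (Even.pow_of_ne_zero even_two (by omega)), hζ.inv.pow_eq_one]
    refine (pow_eq_one_iff_of_nonneg (abs_nonneg _) (n := 2 ^ r) (by positivity)).1 ?_
    rw [← abs_pow, ← map_pow, this, map_one, abs_one]
  rw [algebraMap_two_sub hζ hθ, map_mul, map_pow, hζ.norm_sub_one_two (by omega)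
    (Polynomial.cyclotomic.irreducible_rat (by positivity))] at h1
  have h3 := congrArg abs h1
  rw [abs_mul, h2, abs_pow, abs_pow, one_mul, abs_two] at h3
  exact ((pow_left_inj₀ (by norm_num) (abs_nonneg _) two_ne_zero).1 h3).symm

/-- With the weight `2 - θ = -ζ⁻¹ (ζ - 1) ^ 2` the geometric series telescope, and the partial
sums of the basis become orthogonal vectors of equal length. -/
theorem trace_two_sub_mul (hr : 3 ≤ r) (hζ : IsPrimitiveRoot ζ (2 ^ r))
    (hθ : algebraMap K E θ = ζ + (1 : ℤ) * ζ⁻¹) (hK : Algebra.adjoin ℚ {(θ : K)} = ⊤)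
    {i j : ℕ} (hi : i < 2 ^ (r - 2)) (hj : j < 2 ^ (r - 2)) :
    Algebra.trace ℚ K ((2 - (θ : K)) * ((∑ k ∈ Finset.range (i + 1), dicksonBasis 1 (θ : K) k) *
      (∑ k ∈ Finset.range (j + 1), dicksonBasis 1 (θ : K) k))) =
      if i = j then 2 * 2 ^ (r - 2) else 0 := by
  have h0 : ζ ≠ 0 := hζ.ne_zero (by positivity)
  set x := ∑ k ∈ Finset.range (i + 1), dicksonBasis 1 (θ : K) k with hx
  set y := ∑ k ∈ Finset.range (j + 1), dicksonBasis 1 (θ : K) k with hy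
  have hpow : 2 ^ (r - 1) = 2 * 2 ^ (r - 2) := by
    rw [← pow_succ', show r - 2 + 1 = r - 1 by omega]
  have h2 : ((2 ^ (r - 1) : ℕ) : ℤ) = 2 * (2 ^ (r - 2) : ℕ) := by exact_mod_cast hpow
  have h2' : (2 : ℚ) ^ (r - 1) = 2 * 2 ^ (r - 2) := by exact_mod_cast hpow
  push_cast at h2
  have hi' : (i : ℤ) < 2 ^ (r - 2) := by exact_mod_cast hi
  have hj' : (j : ℤ) < 2 ^ (r - 2) := by exact_mod_cast hj
  have h := two_mul_trace hr hζ (Or.inl rfl) hθ hK ((2 - (θ : K)) * (x * y))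
  have h1 : algebraMap K E ((2 - (θ : K)) * (x * y)) =
      ζ ^ (i - j : ℤ) + ζ ^ (j - i : ℤ) - (ζ ^ (i + j + 1 : ℤ) + ζ ^ (-(i + j + 1) : ℤ)) := by
    calc algebraMap K E ((2 - (θ : K)) * (x * y))
        = -ζ⁻¹ * (algebraMap K E x * (ζ - 1)) * (algebraMap K E y * (ζ - 1)) := by
          rw [map_mul, map_mul, algebraMap_two_sub hζ hθ]
          ring
      _ = _ := by
          rw [sum_dicksonBasis_mul hζ hθ, sum_dicksonBasis_mul hζ hθ, neg_add, neg_add]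
          simp only [zpow_add₀ h0, zpow_sub₀ h0, zpow_neg, zpow_natCast, zpow_one, inv_pow]
          field_simp
          ring
  rw [h1, map_sub, map_add, map_add, trace_zpow (by omega) hζ (by rw [abs_lt]; omega),
    trace_zpow (by omega) hζ (by rw [abs_lt]; omega),
    trace_zpow (by omega) hζ (by rw [abs_lt]; omega),
    trace_zpow (by omega) hζ (by rw [abs_lt]; omega), if_neg (by omega : ¬ (i + j + 1 : ℤ) = 0),
    if_neg (by omega : ¬ (-(i + j + 1) : ℤ) = 0), h2'] at h
  split_ifs at h ⊢ <;> first | omega | linarith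

theorem euclideanMinimum_real_le [Normal ℚ K] (hr : 3 ≤ r) (hζ : IsPrimitiveRoot ζ (2 ^ r))
    (hθ : algebraMap K E θ = ζ + (1 : ℤ) * ζ⁻¹) (hK : Algebra.adjoin ℚ {(θ : K)} = ⊤) :
    euclideanMinimum K ≤
      ((((2 : ℝ) ^ Module.finrank ℚ K)⁻¹ * √|(discr K : ℝ)| : ℝ) : EReal) := by
  have hn := finrank_rat_eq hr hζ (Or.inl rfl) hθ hK
  obtain ⟨τ, hτ, hτb⟩ := exists_isComplexConjugation hζ (Or.inl rfl) hθ
  refine euclideanMinimum_le fun x => ?_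
  obtain ⟨y, hy⟩ := exists_abs_norm_mul_norm_sub_sq_le hτ (apply_two_sub_eq_norm hζ hθ)
    (span_sum_dicksonBasis hr hζ hθ hK) (d := fun _ => 2 * 2 ^ (r - 2))
    (fun _ => by positivity) (fun i j => by
      simp only [map_sum, map_dicksonBasis, hτb, Int.cast_one, one_pow, one_mul]
      rw [trace_two_sub_mul hr hζ hθ hK i.2 j.2]
      simp only [Fin.ext_iff]) x
  refine ⟨y, abs_le_inv_two_pow_mul_sqrt ?_⟩
  have hdisc : |(discr K : ℝ)| = (2 ^ (r - 2)) ^ 2 ^ (r - 2) * 2 ^ (2 ^ (r - 2) - 1) := by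
    exact_mod_cast abs_discr_eq hr hζ (Or.inl rfl) hθ hK
  have h4 : ((∑ _i : Fin (2 ^ (r - 2)), 2 * (2 : ℚ) ^ (r - 2)) / (4 * (2 ^ (r - 2) : ℕ))) =
      2 * 2 ^ (r - 2) / 4 := by
    simp
    field_simp
  rw [hn] at hy ⊢
  rw [hdisc]
  rw [h4, abs_norm_two_sub hr hζ hθ hK, div_pow, le_div_iff₀ (by positivity), mul_pow] at hy
  obtain ⟨m, hm⟩ : ∃ m, 2 ^ (r - 2) = m + 1 := Nat.exists_eq_succ_of_ne_zero (by positivity)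
  rw [hm] at hy ⊢
  rw [Nat.add_sub_cancel]
  have hy' : (2 : ℝ) * (Algebra.norm ℚ (x - (y : K)) : ℝ) ^ 2 * 4 ^ (m + 1) ≤
      2 ^ (m + 1) * (2 ^ (r - 2)) ^ (m + 1) := by exact_mod_cast hy
  rw [pow_succ (2 : ℝ) m] at hy'
  linarith

end RealSubfield

/-! ### Subfields of conductor `2 ^ r` -/

section Classification

/-- Every nontrivial element congruent to `1` modulo `4` of the unit group modulo `2 ^ r` has `1 +
2 ^ (r - 1)` as a power: squaring raises `s` by one and keeps `u` odd. -/
theorem exists_pow_modEq_one_add_two_pow {r : ℕ} (d : ℕ) : ∀ {s u : ℕ}, s + d = r - 1 → 2 ≤ s →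
    Odd u → ∃ m, (1 + 2 ^ s * u) ^ m ≡ 1 + 2 ^ (r - 1) [MOD 2 ^ r] := by
  induction d with
  | zero =>
    intro s u hs h2 hu
    obtain ⟨v, rfl⟩ := hu
    refine ⟨1, ?_⟩
    have h : (1 + 2 ^ s * (2 * v + 1)) ^ 1 = 1 + 2 ^ (r - 1) + 2 ^ r * v := by
      obtain rfl : r = s + 1 := by omega
      rw [Nat.add_sub_cancel, pow_succ 2 s]
      ring
    rw [h]
    exact (Nat.modEq_iff_dvd' (by omega)).2 ⟨v, by omega⟩ |>.symm
  | succ d ih =>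
    intro s u hs h2 hu
    obtain ⟨t, rfl⟩ : ∃ t, s = t + 1 := ⟨s - 1, by omega⟩
    -- `(1 + 2 ^ s * u) ^ 2 = 1 + 2 ^ (s + 1) * (u + 2 ^ (s - 1) * u ^ 2)` with `s = t + 1`
    obtain ⟨m, hm⟩ := ih (s := t + 2) (u := u + 2 ^ t * u ^ 2) (by omega) (by omega)
      (hu.add_even ((Even.pow_of_ne_zero even_two (by omega)).mul_right _))
    refine ⟨2 * m, ?_⟩
    rw [pow_mul]
    convert hm using 2
    ring

variable {E : Type*} [Field E] [NumberField E] {r : ℕ} {ζ : E}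

theorem exists_odd_apply_eq_pow (hr : 3 ≤ r) (hζ : IsPrimitiveRoot ζ (2 ^ r)) (σ : E ≃ₐ[ℚ] E) :
    ∃ a < 2 ^ r, Odd a ∧ σ ζ = ζ ^ a := by
  have hσ : IsPrimitiveRoot (σ ζ) (2 ^ r) := hζ.map_of_injective σ.injective
  obtain ⟨a, ha, h⟩ := hζ.eq_pow_of_pow_eq_one hσ.pow_eq_one
  refine ⟨a, ha, ?_, h.symm⟩
  rw [← h, hζ.pow_iff_coprime (by positivity), Nat.coprime_pow_right_iff (by omega)] at hσ
  exact Nat.coprime_two_right.1 hσ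

theorem apply_eq_or_eq_neg_inv (hr : 3 ≤ r) (hζ : IsPrimitiveRoot ζ (2 ^ r)) {σ : E ≃ₐ[ℚ] E}
    (hσ1 : σ * σ = 1) {a : ℕ} (ha4 : a % 4 = 3) (hσ : σ ζ = ζ ^ a) :
    ∃ ε : ℤ, (ε = 1 ∨ ε = -1) ∧ σ ζ = ε * ζ⁻¹ := by
  have h0 : ζ ≠ 0 := hζ.ne_zero (by positivity)
  have hσσ : σ (ζ ^ a) = ζ := by
    rw [← hσ, ← AlgEquiv.mul_apply, hσ1, AlgEquiv.one_apply]
  -- The product `ζ * σ ζ` is fixed by `σ`, which raises it to the power `a`.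
  have h1 : (ζ ^ (a + 1)) ^ (a - 1) = 1 := by
    have h2 : σ (ζ ^ (a + 1)) = ζ ^ (a + 1) := by
      rw [pow_succ, map_mul, hσσ, hσ, mul_comm]
    rw [map_pow, hσ, ← pow_mul, mul_comm, pow_mul] at h2
    have h3 : (ζ ^ (a + 1)) ^ (a - 1) * ζ ^ (a + 1) = 1 * ζ ^ (a + 1) := by
      rw [← pow_succ, show a - 1 + 1 = a by omega, h2, one_mul]
    exact mul_right_cancel₀ (pow_ne_zero _ h0) h3
  have h2 : (ζ ^ (a + 1)) ^ 2 ^ r = 1 := by rw [pow_right_comm, hζ.pow_eq_one, one_pow]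
  have hgcd : Nat.gcd (a - 1) (2 ^ r) = 2 := by
    rw [show a - 1 = 2 * ((a - 1) / 2) by omega, show 2 ^ r = 2 * 2 ^ (r - 1) by
      rw [← pow_succ']; congr 1; omega, Nat.gcd_mul_left,
      Nat.Coprime.pow_right _ (Nat.coprime_two_right.2 (Nat.odd_iff.2 (by omega)))]
  have h3 := pow_gcd_eq_one.2 ⟨h1, h2⟩
  rw [hgcd] at h3
  rcases sq_eq_one_iff.1 h3 with h | h
  · exact ⟨1, Or.inl rfl, by rw [hσ]; field_simp; rw [← pow_succ, h]; simp⟩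
  · exact ⟨-1, Or.inr rfl, by rw [hσ]; field_simp; rw [← pow_succ, h]; simp⟩

variable [IsCyclotomicExtension {2 ^ r} ℚ E]

theorem algEquiv_eq_one (hζ : IsPrimitiveRoot ζ (2 ^ r)) {σ : E ≃ₐ[ℚ] E} (h : σ ζ = ζ) :
    σ = 1 := by
  have h1 : (σ : E →ₐ[ℚ] E) = AlgHom.id ℚ E := by
    refine AlgHom.ext_of_adjoin_eq_top
      (IsCyclotomicExtension.adjoin_primitive_root_eq_top hζ) ?_
    rintro _ rfl
    simpa using h
  exact AlgEquiv.ext fun x => DFunLike.congr_fun h1 x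

theorem exists_pow_apply_eq_neg (hr : 3 ≤ r) (hζ : IsPrimitiveRoot ζ (2 ^ r)) {σ : E ≃ₐ[ℚ] E}
    (hσ1 : σ ≠ 1) {a : ℕ} (ha : a < 2 ^ r) (ha4 : a % 4 = 1) (hσ : σ ζ = ζ ^ a) :
    ∃ m : ℕ, (σ ^ m) ζ = -ζ := by
  have hne : a ≠ 1 := by
    rintro rfl
    exact hσ1 (algEquiv_eq_one hζ (by simpa using hσ))
  obtain ⟨s, u, hu, hsu⟩ := Nat.exists_eq_two_pow_mul_odd (n := a - 1) (by omega)
  have hs2 : 2 ≤ s := by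
    by_contra hs
    obtain ⟨v, rfl⟩ := hu
    have : s = 0 ∨ s = 1 := by omega
    rcases this with rfl | rfl <;> simp at hsu <;> omega
  have hsr : s < r := by
    refine (Nat.pow_lt_pow_iff_right one_lt_two).1 (lt_of_le_of_lt ?_ ha)
    calc 2 ^ s ≤ 2 ^ s * u := Nat.le_mul_of_pos_right _ hu.pos
      _ ≤ a := by omega
  obtain ⟨m, hm⟩ := exists_pow_modEq_one_add_two_pow (r := r) (r - 1 - s) (s := s) (by omega) hs2 hu
  rw [← hsu, show 1 + (a - 1) = a by omega] at hm
  have hpow : ∀ k : ℕ, (σ ^ k) ζ = ζ ^ a ^ k := fun k => by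
    induction k with
    | zero => simp
    | succ k ih => rw [pow_succ, AlgEquiv.mul_apply, hσ, map_pow, ih, ← pow_mul, pow_succ]
  have hm' : ζ ^ a ^ m = ζ ^ (1 + 2 ^ (r - 1)) := by
    rw [← pow_mod_orderOf, ← hζ.eq_orderOf, show a ^ m % 2 ^ r = _ from hm]
    conv_lhs => rw [hζ.eq_orderOf, pow_mod_orderOf]
  refine ⟨m, ?_⟩
  rw [hpow, hm', pow_add,
    hζ.two_pow_half (by omega), pow_one, mul_neg_one]

theorem mem_adjoin_simple_of_fixed (hζ : IsPrimitiveRoot ζ (2 ^ r)) {σ : E ≃ₐ[ℚ] E} {y p q : E}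
    (hp : p ∈ ℚ⟮y⟯) (hq : q ∈ ℚ⟮y⟯) (h : ζ * ζ = p * ζ + q) (hy : σ y = y) (hσ : σ ζ ≠ ζ) {x : E}
    (hx : σ x = x) : x ∈ ℚ⟮y⟯ := by
  refine mem_of_fixed_of_mem_adjoin (S := ℚ⟮y⟯.toSubalgebra) hp hq h (fun s hs => ?_) hσ
    (IsCyclotomicExtension.adjoin_primitive_root_eq_top (A := ℚ) hζ ▸ Algebra.mem_top) hx
  replace hs : s ∈ ℚ⟮y⟯ := hs
  induction hs using adjoin_induction with
  | mem s hs => rw [Set.mem_singleton_iff.1 hs, hy]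
  | algebraMap c => exact σ.commutes c
  | add s t _ _ hs ht => rw [map_add, hs, ht]
  | mul s t _ _ hs ht => rw [map_mul, hs, ht]
  | inv s _ hs => rw [map_inv₀, hs]

/-- The classification inside `ℚ(ζ)`, by the Galois group of `ℚ(ζ)` over the subfield. -/
theorem eq_top_or_eq_adjoin (hr : 3 ≤ r) (hζ : IsPrimitiveRoot ζ (2 ^ r))
    {F : IntermediateField ℚ E} (hF : ¬ F ≤ ℚ⟮ζ ^ 2⟯) :
    F = ⊤ ∨ F = ℚ⟮ζ + ζ⁻¹⟯ ∨ F = ℚ⟮ζ - ζ⁻¹⟯ := by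
  have h0 : ζ ≠ 0 := hζ.ne_zero (by positivity)
  have : IsGalois ℚ E := IsCyclotomicExtension.isGalois {2 ^ r} ℚ E
  have hH : ∀ σ ∈ F.fixingSubgroup, ∀ a < 2 ^ r, a % 4 = 1 → σ ζ = ζ ^ a → σ = 1 := by
    intro σ hσF a ha ha4 hσ
    by_contra hσ1
    obtain ⟨m, hm⟩ := exists_pow_apply_eq_neg hr hζ hσ1 ha ha4 hσ
    refine hF fun x hx => ?_
    refine mem_adjoin_simple_of_fixed hζ (p := 0) (q := ζ ^ 2) (σ := σ ^ m) (zero_mem _)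
      (mem_adjoin_simple_self ℚ _) (by ring) (by rw [map_pow, hm, neg_sq]) ?_
      ((mem_fixingSubgroup_iff F _).1 (pow_mem hσF m) x hx)
    rw [hm]
    intro h
    have : (2 : E) * ζ = 0 := by linear_combination -h
    simp [h0] at this
  -- Elements of `F.fixingSubgroup` other than `1` have exponent `3` modulo `4`, so the product of
  -- any two of them has exponent `1` modulo `4` and is trivial; hence there is at most one of them.
  by_cases hall : ∀ σ ∈ F.fixingSubgroup, σ = 1
  · left
    rw [← IsGalois.fixedField_fixingSubgroup F, (Subgroup.eq_bot_iff_forall _).2 hall,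
      fixedField_bot]
  push Not at hall
  obtain ⟨τ, hτF, hτ1⟩ := hall
  have h3 : ∀ σ ∈ F.fixingSubgroup, σ ≠ 1 → ∃ a, a % 4 = 3 ∧ σ ζ = ζ ^ a := by
    intro σ hσF hσ1
    obtain ⟨a, ha, hodd, hσ⟩ := exists_odd_apply_eq_pow hr hζ σ
    rw [Nat.odd_iff] at hodd
    have : a % 4 ≠ 1 := fun h => hσ1 (hH σ hσF a ha h hσ)
    exact ⟨a, by omega, hσ⟩
  have hmul : ∀ σ ∈ F.fixingSubgroup, σ ≠ 1 → ∀ ρ ∈ F.fixingSubgroup, ρ ≠ 1 → σ * ρ = 1 := by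
    intro σ hσF hσ1 ρ hρF hρ1
    obtain ⟨a, ha, hσ⟩ := h3 σ hσF hσ1
    obtain ⟨b, hb, hρ⟩ := h3 ρ hρF hρ1
    refine hH _ (mul_mem hσF hρF) (a * b % 2 ^ r) (Nat.mod_lt _ (by positivity)) ?_ ?_
    · have h4 : 4 ∣ 2 ^ r := pow_dvd_pow 2 (by omega : 2 ≤ r)
      rw [Nat.mod_mod_of_dvd _ h4, Nat.mul_mod, ha, hb]
    · rw [AlgEquiv.mul_apply, hρ, map_pow, hσ, ← pow_mul, hζ.eq_orderOf, pow_mod_orderOf]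
  obtain ⟨a, ha4, hτ⟩ := h3 τ hτF hτ1
  obtain ⟨ε, hε, hτε⟩ := apply_eq_or_eq_neg_inv hr hζ (hmul τ hτF hτ1 τ hτF hτ1) ha4 hτ
  have hε2 : (ε : E) * ε = 1 := by rcases hε with rfl | rfl <;> simp
  have hτθ : τ (ζ + ε * ζ⁻¹) = ζ + ε * ζ⁻¹ := by
    rw [map_add, map_mul, map_inv₀, map_intCast, hτε, mul_inv, inv_inv,
      inv_eq_of_mul_eq_one_left hε2, ← mul_assoc, hε2, one_mul, add_comm]
  have hFθ : F = ℚ⟮ζ + ε * ζ⁻¹⟯ := by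
    refine le_antisymm (fun x hx => ?_) ?_
    · refine mem_adjoin_simple_of_fixed hζ (p := ζ + ε * ζ⁻¹) (q := -(ε : E)) (σ := τ)
        (mem_adjoin_simple_self ℚ _) (neg_mem (intCast_mem _ ε)) (by field_simp; ring) hτθ
        (fun h => hτ1 (algEquiv_eq_one hζ h)) ((mem_fixingSubgroup_iff F _).1 hτF x hx)
    · rw [adjoin_simple_le_iff, ← IsGalois.fixedField_fixingSubgroup F, mem_fixedField_iff]
      intro σ hσF
      by_cases hσ1 : σ = 1
      · rw [hσ1, AlgEquiv.one_apply]
      · rw [mul_left_cancel ((hmul τ hτF hτ1 σ hσF hσ1).trans (hmul τ hτF hτ1 τ hτF hτ1).symm)]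
        exact hτθ
  rcases hε with rfl | rfl
  · exact Or.inr (Or.inl (by simpa using hFθ))
  · exact Or.inr (Or.inr (by simpa [← sub_eq_add_neg] using hFθ))

end Classification

/-! ### Fields inside an arbitrary field of characteristic zero -/

theorem exists_basis_conjTraceForm_eq_diagonal_and_abs_discr_eq {K E : Type*} [Field K]
    [NumberField K] [Field E] [NumberField E] [Algebra K E]
    [Normal ℚ K] {r : ℕ} [IsCyclotomicExtension {2 ^ r} ℚ E] {ζ : E} {θ : 𝓞 K} (hr : 3 ≤ r)
    (hζ : IsPrimitiveRoot ζ (2 ^ r)) (hθ : algebraMap K E θ = ζ + (-1 : ℤ) * ζ⁻¹)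
    (hK : Algebra.adjoin ℚ {(θ : K)} = ⊤) {n : ℕ} (hn : n = Module.finrank ℚ K) :
    (∃ τ : K ≃+* K, IsComplexConjugation τ ∧ ∃ b : Module.Basis (Fin n) ℤ (𝓞 K),
        Matrix.of (fun i j => conjTraceForm τ (b i) (b j)) =
          Matrix.diagonal (fun i : Fin n => if i.val = 0 then (n : ℚ) else 2 * (n : ℚ))) ∧
      |discr K| = (n : ℤ) ^ n * 2 ^ (n - 1) := by
  have hε : (-1 : ℤ) = 1 ∨ (-1 : ℤ) = -1 := Or.inr rfl
  obtain rfl : n = 2 ^ (r - 2) := hn.trans (finrank_rat_eq hr hζ hε hθ hK)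
  refine ⟨?_, by exact_mod_cast abs_discr_eq hr hζ hε hθ hK⟩
  obtain ⟨τ, hτ, hτb⟩ := exists_isComplexConjugation hζ hε hθ
  obtain ⟨b, hb⟩ := exists_basis_dicksonBasis hr hζ hε hθ hK
  refine ⟨τ, hτ, b, ?_⟩
  ext i j
  rw [Matrix.of_apply, conjTraceForm, hb, hb]
  simp only [map_dicksonBasis]
  rw [trace_dicksonBasis_mul_conj hr hζ hε hθ hK hτb i.2 j.2, Matrix.diagonal_apply]
  simp only [Fin.ext_iff]
  push_cast
  rfl

section Ambient

variable {L : Type*} [Field L] [CharZero L] {r : ℕ} {ζ : L}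

/-- The conductor can be tested on any primitive root, as any two of them are powers of each
other. -/
theorem hasConductorTwoPow_iff (hζ : IsPrimitiveRoot ζ (2 ^ r)) (K : IntermediateField ℚ L) :
    HasConductorTwoPow K r ↔ K ≤ ℚ⟮ζ⟯ ∧ ¬ K ≤ ℚ⟮ζ ^ 2⟯ := by
  refine ⟨?_, fun h => ⟨ζ, hζ, h⟩⟩
  rintro ⟨η, hη, h1, h2⟩
  have key : ∀ {x y : L}, IsPrimitiveRoot x (2 ^ r) → IsPrimitiveRoot y (2 ^ r) → ∀ k : ℕ,
      ℚ⟮x ^ k⟯ ≤ ℚ⟮y ^ k⟯ := fun {x y} hx hy k => by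
    obtain ⟨i, -, rfl⟩ := hy.eq_pow_of_pow_eq_one hx.pow_eq_one
    rw [adjoin_simple_le_iff, pow_right_comm]
    exact pow_mem (mem_adjoin_simple_self ℚ _) i
  exact ⟨h1.trans (by simpa using key hη hζ 1), fun h => h2 (h.trans (key hζ hη 2))⟩

theorem isCyclotomicExtension_adjoin_simple (hζ : IsPrimitiveRoot ζ (2 ^ r)) :
    IsCyclotomicExtension {2 ^ r} ℚ ℚ⟮ζ⟯ := by
  change IsCyclotomicExtension {2 ^ r} ℚ ℚ⟮ζ⟯.toSubalgebra
  rw [adjoin_simple_toSubalgebra_of_isAlgebraic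
    ((hζ.isIntegral (by positivity)).tower_top (A := ℚ)).isAlgebraic]
  exact hζ.adjoin_isCyclotomicExtension ℚ

theorem isPrimitiveRoot_gen (hζ : IsPrimitiveRoot ζ (2 ^ r)) :
    IsPrimitiveRoot (AdjoinSimple.gen ℚ ζ) (2 ^ r) :=
  IsPrimitiveRoot.of_map_of_injective (f := algebraMap ℚ⟮ζ⟯ L) hζ (algebraMap ℚ⟮ζ⟯ L).injective

theorem eq_of_hasConductorTwoPow (hr : 3 ≤ r) (hζ : IsPrimitiveRoot ζ (2 ^ r))
    {K : IntermediateField ℚ L} (hK : HasConductorTwoPow K r) :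
    K = ℚ⟮ζ⟯ ∨ K = ℚ⟮ζ + ζ⁻¹⟯ ∨ K = ℚ⟮ζ - ζ⁻¹⟯ := by
  obtain ⟨h1, h2⟩ := (hasConductorTwoPow_iff hζ K).1 hK
  have := isCyclotomicExtension_adjoin_simple hζ
  have : NumberField ℚ⟮ζ⟯ := IsCyclotomicExtension.numberField {2 ^ r} ℚ _
  have hz := isPrimitiveRoot_gen hζ
  have hF : ¬ restrict h1 ≤ ℚ⟮AdjoinSimple.gen ℚ ζ ^ 2⟯ := fun h => h2 fun x hx => by
    have h3 : lift (restrict h1) ≤ lift ℚ⟮AdjoinSimple.gen ℚ ζ ^ 2⟯ := map_mono _ h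
    rw [lift_restrict, lift_adjoin_simple] at h3
    simpa using h3 hx
  have h4 : restrict h1 = ⊤ ∨
      restrict h1 = ℚ⟮AdjoinSimple.gen ℚ ζ + (AdjoinSimple.gen ℚ ζ)⁻¹⟯ ∨
      restrict h1 = ℚ⟮AdjoinSimple.gen ℚ ζ - (AdjoinSimple.gen ℚ ζ)⁻¹⟯ :=
    eq_top_or_eq_adjoin hr hz hF
  rw [← lift_restrict h1]
  rcases h4 with h | h | h
  · left
    rw [h, lift_top]
  · right; left
    exact (congrArg lift h).trans (lift_adjoin_simple ..)
  · right; right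
    exact (congrArg lift h).trans (lift_adjoin_simple ..)

end Ambient

theorem mainTheorem1 {L : Type*} [Field L] [CharZero L] (r : ℕ) (hr : 3 ≤ r)
    (ζ : L) (hζ : IsPrimitiveRoot ζ (2 ^ r))
    (K : IntermediateField ℚ L) [NumberField K] [IsAbelianGalois ℚ K]
    (hK : HasConductorTwoPow K r) (n : ℕ) (hn : n = Module.finrank ℚ K) :
    (K = ℚ⟮ζ⟯ ∨ K = ℚ⟮ζ + ζ⁻¹⟯ ∨ K = ℚ⟮ζ - ζ⁻¹⟯) ∧
    (K = ℚ⟮ζ⟯ ∨ K = ℚ⟮ζ + ζ⁻¹⟯ →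
      euclideanMinimum K ≤ ((((2 : ℝ) ^ n)⁻¹ * √|(discr K : ℝ)| : ℝ) : EReal)) ∧
    (K = ℚ⟮ζ - ζ⁻¹⟯ →
      euclideanMinimum K ≤ ((((2 : ℝ) ^ n)⁻¹ * (2 * (n : ℝ) - 1) ^ ((n : ℝ) / 2) : ℝ) : EReal) ∧
      (∃ τ : K ≃+* K, IsComplexConjugation τ ∧
        ∃ b : Module.Basis (Fin n) ℤ (𝓞 K),
          Matrix.of (fun i j => conjTraceForm τ (b i) (b j)) =
            Matrix.diagonal (fun i : Fin n => if i.val = 0 then (n : ℚ) else 2 * (n : ℚ))) ∧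
      |discr K| = (n : ℤ) ^ n * 2 ^ (n - 1)) := by
  have hcycl := isCyclotomicExtension_adjoin_simple hζ
  have hnf : NumberField ℚ⟮ζ⟯ := IsCyclotomicExtension.numberField {2 ^ r} ℚ _
  have hz := isPrimitiveRoot_gen hζ
  have hKζ := ((hasConductorTwoPow_iff hζ K).1 hK).1
  let : Algebra K ℚ⟮ζ⟯ := (inclusion hKζ).toRingHom.toAlgebra
  have hnormal : Normal ℚ K := inferInstance
  have hgen : ∀ ε : ℤ, K = ℚ⟮ζ + ε * ζ⁻¹⟯ → ∃ θ : 𝓞 K,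
      algebraMap K ℚ⟮ζ⟯ θ = AdjoinSimple.gen ℚ ζ + ε * (AdjoinSimple.gen ℚ ζ)⁻¹ ∧
      Algebra.adjoin ℚ {(θ : K)} = ⊤ := by
    rintro ε rfl
    have hint : IsIntegral ℤ (ζ + ε * ζ⁻¹) :=
      (hζ.isIntegral (by positivity)).add
        ((isIntegral_algebraMap (R := ℤ) (x := ε)).mul (hζ.inv.isIntegral (by positivity)))
    have hint' : IsIntegral ℤ (AdjoinSimple.gen ℚ (ζ + ε * ζ⁻¹)) := by
      refine (isIntegral_algHom_iff ((algebraMap ℚ⟮ζ + ε * ζ⁻¹⟯ L).toIntAlgHom)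
        (algebraMap ℚ⟮ζ + ε * ζ⁻¹⟯ L).injective).1 ?_
      exact hint
    refine ⟨⟨AdjoinSimple.gen ℚ (ζ + ε * ζ⁻¹), hint'⟩, ?_, ?_⟩
    · refine (algebraMap ℚ⟮ζ⟯ L).injective ?_
      simp
      rfl
    · have := (adjoin.powerBasis (hint.tower_top (A := ℚ))).adjoin_gen_eq_top
      rwa [adjoin.powerBasis_gen] at this
  refine ⟨eq_of_hasConductorTwoPow hr hζ hK, ?_, fun h => ?_⟩
  · rintro (h | h)
    · subst h
      rw [hn]
      exact euclideanMinimum_cyclotomic_le hr hz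
    · obtain ⟨θ, hθ, hKθ⟩ := hgen 1 (by simpa using h)
      rw [hn]
      exact euclideanMinimum_real_le hr hz hθ hKθ
  · obtain ⟨θ, hθ, hKθ⟩ := hgen (-1) (by simpa [← sub_eq_add_neg] using h)
    refine ⟨?_, exists_basis_conjTraceForm_eq_diagonal_and_abs_discr_eq hr hz hθ hKθ hn⟩
    rw [hn]
    exact euclideanMinimum_skew_le hr hz hθ hKθ
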